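/- Let $f:\mathbb{R}^d\to\mathbb{R}$ be bounded below and $L$-smooth with $L>0$, i.e. $f$ is differentiable and $\|\nabla f(x)-\nabla f(y)\|\le L\|x-y\|$ for all $x,y$. For $\sigma>0$ let $$f_\sigma(x)=\frac{1}{\pi^{d/2}}\int_{\mathbb{R}^d} f(x+\sigma u)\,e^{-\|u\|^2}\,du ,$$ and let $\delta_\sigma(x;u)$ be either one of the two finite differences $$\frac{f(x+\sigma u)-f(x)}{\sigma/2}\qquad\text{or}\qquad\frac{f(x+\sigma u)-f(x-\sigma u)}{\sigma}$$ (the same choice throughout). Let $N\ge 1$, let $(\sigma_n)_{n\ge1}$ be a sequence of positive real numbers, let $0<t<\frac{1}{2L(d+4)}$, and let $x_0\in\mathbb{R}^d$ be deterministic. Define random points by $$x_{k+1}=x_k-t\,g_{k+1},\qquad g_{k+1}=\frac1N\sum_{n=1}^{N}\delta_{\sigma_{k+1}}(x_k;u_{k,n})\,u_{k,n},\qquad k=0,1,2,\dots,$$ where the samples $u_{k,n}$ ($k\ge 0$, $1\le n\le N$) are independent random vectors, each with density $\pi^{-d/2}e^{-\|u\|^2}$ on $\mathbb{R}^d$. Then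 for every $k\ge1$ the integrals defining $f_{\sigma_k}$ converge absolutely at every point, $\|\nabla f(x_i)\|^2$ (for every $i\geq 0$) and $f_{\sigma_k}(x_k)$ are integrable, and $$\min_{0\le i\le k-1}\mathbb{E}\|\nabla f(x_i)\|^2\le\frac1k\left(\frac{N}{N-2Lt(d+4)}\right)\left(\frac{4\big(f(x_0)-\mathbb{E}[f_{\sigma_k}(x_k)]\big)}{t}+\left(\frac{L^3t(d+6)^3}{4N}+\frac{2Ld}{t}\right)\sum_{i=1}^{k}\sigma_i^2\right).$$ -/

import Mathlib

open scoped Gradient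

/-- `f` is `L`-smooth: it is differentiable and its gradient is `L`-Lipschitz. -/
def LSmooth {d : ℕ} (L : ℝ) (f : EuclideanSpace ℝ (Fin d) → ℝ) : Prop :=
  Differentiable ℝ f ∧
    ∀ x y : EuclideanSpace ℝ (Fin d), ‖∇ f x - ∇ f y‖ ≤ L * ‖x - y‖

/-- The Gaussian smoothing `f_σ(x) = π^(-d/2) ∫ f(x + σ u) exp(-‖u‖²) du`. -/
noncomputable def gaussSmooth {d : ℕ} (f : EuclideanSpace ℝ (Fin d) → ℝ) (σ : ℝ)
    (x : EuclideanSpace ℝ (Fin d)) : ℝ :=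
  1 / Real.pi ^ ((d : ℝ) / 2) *
    ∫ u : EuclideanSpace ℝ (Fin d), f (x + σ • u) * Real.exp (-‖u‖ ^ 2)

/-- The probability distribution on `ℝ^d` with density `π^(-d/2) exp(-‖u‖²)`, that is, the centred
Gaussian with covariance `(1/2) I`. -/
noncomputable def samplingMeasure (d : ℕ) :
    MeasureTheory.Measure (EuclideanSpace ℝ (Fin d)) :=
  MeasureTheory.volume.withDensity fun u =>
    ENNReal.ofReal (1 / Real.pi ^ ((d : ℝ) / 2) * Real.exp (-‖u‖ ^ 2))

/-- The forward difference `(f(x + σ u) - f(x)) / (σ/2)`. -/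
noncomputable def forwardDiff {d : ℕ} (f : EuclideanSpace ℝ (Fin d) → ℝ) (σ : ℝ)
    (x u : EuclideanSpace ℝ (Fin d)) : ℝ :=
  (f (x + σ • u) - f x) / (σ / 2)

/-- The central difference `(f(x + σ u) - f(x - σ u)) / σ`. -/
noncomputable def centralDiff {d : ℕ} (f : EuclideanSpace ℝ (Fin d) → ℝ) (σ : ℝ)
    (x u : EuclideanSpace ℝ (Fin d)) : ℝ :=
  (f (x + σ • u) - f (x - σ • u)) / σ

/-- The `N`-point Monte Carlo estimate `g_σ(x; N) = (1/N) ∑ₙ δ_σ(x; uₙ) uₙ` built from a finite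
difference scheme `δ` (with arguments `σ`, `x`, `u`) and from the samples `u₁, …, u_N`. -/
noncomputable def mcGradient {d N : ℕ}
    (δ : ℝ → EuclideanSpace ℝ (Fin d) → EuclideanSpace ℝ (Fin d) → ℝ)
    (σ : ℝ) (x : EuclideanSpace ℝ (Fin d)) (u : Fin N → EuclideanSpace ℝ (Fin d)) :
    EuclideanSpace ℝ (Fin d) :=
  (1 / (N : ℝ)) • ∑ n, δ σ x (u n) • u n

/-- The iterates `x_{k+1} = x_k - t g_{σ_{k+1}}(x_k; N)` along one realization of the samples;
`u k 0, …, u k (N-1)` are the samples drawn for the step from `x_k` to `x_{k+1}`. -/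
noncomputable def mcIterate {d N : ℕ}
    (δ : ℝ → EuclideanSpace ℝ (Fin d) → EuclideanSpace ℝ (Fin d) → ℝ)
    (σ : ℕ → ℝ) (t : ℝ) (x₀ : EuclideanSpace ℝ (Fin d))
    (u : ℕ → Fin N → EuclideanSpace ℝ (Fin d)) : ℕ → EuclideanSpace ℝ (Fin d)
  | 0 => x₀
  | k + 1 => mcIterate δ σ t x₀ u k -
      t • mcGradient δ (σ (k + 1)) (mcIterate δ σ t x₀ u k) (u k)

/-!
Along one step `x' = x - t g` the function `f` itself, rather than a smoothing of it, serves as the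
Lyapunov function. Both finite differences satisfy `|δ_s(x; v) - 2 ⟪∇ f x, v⟫| ≤ L s ‖v‖²`
(`LSmooth.abs_forwardDiff_sub_le`, `LSmooth.abs_centralDiff_sub_le`). The descent lemma for
`L`-smooth functions and Jensen's inequality for `‖g‖²` therefore bound `f x' - f x` by the average
over the samples `v` of a polynomial `decreaseBound` in `a = ∇ f x` and `v` (`LSmooth.step_le`).
Its expectation needs only the Gaussian moments `E ⟪a, v⟫² = ‖a‖² / 2`,
`E ⟪a, v⟫² ‖v‖² = (d + 2) ‖a‖² / 4`, `E ‖v‖⁴` and `E ‖v‖⁶`, which follow by integration by parts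
(`two_mul_integral_mul_inner_eq`), and the independence of each sample from the current iterate,
which depends on earlier samples only (`indepFun_mcIterate`).

Under `2 L t (d + 4) < 1` this gives
`E f(x_{i+1}) ≤ E f(x_i) - (t / 4) E ‖∇ f(x_i)‖² + L d σ_{i+1}² / 4`
(`LSmooth.integrable_and_integral_le_of_step`), and the sum over `i < k` telescopes. Since
`|f_σ - f| ≤ L d σ² / 4` (`LSmooth.abs_gaussSmooth_sub_le`), replacing `E f(x_k)` by
`E f_{σ_k}(x_k)` costs at most `L d σ_k² / 4` more, so that the total error is at most
`(L d / 2) ∑ σ_i²`. The minimum is at most the mean, and the term `L³ t (d + 6)³ / (4 N)` and the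
factor `N / (N - 2 L t (d + 4)) ≥ 1` only weaken the resulting inequality.
-/

open MeasureTheory ProbabilityTheory
open scoped RealInnerProductSpace

/-! ### Moments of the sampling distribution -/

theorem integrable_norm_pow_mul_exp_neg_norm_sq (d m : ℕ) :
    Integrable fun v : EuclideanSpace ℝ (Fin d) => ‖v‖ ^ m * Real.exp (-‖v‖ ^ 2) := by
  have h0 : Integrable fun v : EuclideanSpace ℝ (Fin d) => Real.exp (-(1 / 2) * ‖v‖ ^ 2) := by
    have h := (GaussianFourier.integrable_cexp_neg_mul_sq_norm_add (V := EuclideanSpace ℝ (Fin d))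
      (b := (1 / 2 : ℂ)) (by norm_num) 0 0).norm
    refine h.congr (Filter.Eventually.of_forall fun v => ?_)
    simp only [Complex.norm_exp]
    congr 1
    simp [← Complex.ofReal_pow]
  refine (h0.const_mul (1 + 2 ^ m * (m.factorial : ℝ))).mono' (by fun_prop)
    (Filter.Eventually.of_forall fun v => ?_)
  -- Half of the Gaussian weight absorbs the polynomial factor.
  have hexp : Real.exp (-‖v‖ ^ 2) = Real.exp (-(1 / 2) * ‖v‖ ^ 2) * Real.exp (-(‖v‖ ^ 2 / 2)) := by
    rw [← Real.exp_add]; congr 1; ring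
  have h1 : ‖v‖ ^ m ≤ 1 + (‖v‖ ^ 2) ^ m := by
    rw [← pow_mul, mul_comm 2 m, pow_mul]
    nlinarith [sq_nonneg (‖v‖ ^ m - 1 / 2)]
  have h2 := Real.pow_div_factorial_le_exp (‖v‖ ^ 2 / 2) (by positivity) m
  rw [div_pow, div_div, div_le_iff₀ (by positivity)] at h2
  have h3 : 1 ≤ Real.exp (‖v‖ ^ 2 / 2) := Real.one_le_exp (by positivity)
  have h4 : Real.exp (‖v‖ ^ 2 / 2) * Real.exp (-(‖v‖ ^ 2 / 2)) = 1 := by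
    rw [← Real.exp_add]; simp
  rw [Real.norm_of_nonneg (by positivity), hexp]
  calc ‖v‖ ^ m * (Real.exp (-(1 / 2) * ‖v‖ ^ 2) * Real.exp (-(‖v‖ ^ 2 / 2)))
      ≤ ((1 + 2 ^ m * (m.factorial : ℝ)) * Real.exp (‖v‖ ^ 2 / 2)) *
          (Real.exp (-(1 / 2) * ‖v‖ ^ 2) * Real.exp (-(‖v‖ ^ 2 / 2))) := by
        gcongr; nlinarith
    _ = (1 + 2 ^ m * (m.factorial : ℝ)) * Real.exp (-(1 / 2) * ‖v‖ ^ 2) *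
          (Real.exp (‖v‖ ^ 2 / 2) * Real.exp (-(‖v‖ ^ 2 / 2))) := by ring
    _ = _ := by rw [h4, mul_one]

theorem integrable_samplingMeasure_iff {d : ℕ} {h : EuclideanSpace ℝ (Fin d) → ℝ} :
    Integrable h (samplingMeasure d) ↔ Integrable fun v => h v * Real.exp (-‖v‖ ^ 2) := by
  have hc : (1 / Real.pi ^ ((d : ℝ) / 2)) ≠ 0 := by positivity
  rw [samplingMeasure, integrable_withDensity_iff (by fun_prop) (by simp)]
  rw [← integrable_const_mul_iff hc.isUnit (fun v => h v * Real.exp (-‖v‖ ^ 2))]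
  refine integrable_congr (Filter.Eventually.of_forall fun v => ?_)
  simp only
  rw [ENNReal.toReal_ofReal (by positivity)]
  ring

theorem integral_samplingMeasure {d : ℕ} (h : EuclideanSpace ℝ (Fin d) → ℝ) :
    ∫ v, h v ∂samplingMeasure d =
      1 / Real.pi ^ ((d : ℝ) / 2) * ∫ v, h v * Real.exp (-‖v‖ ^ 2) := by
  rw [samplingMeasure, integral_withDensity_eq_integral_toReal_smul (by fun_prop) (by simp),
    ← integral_const_mul]
  refine integral_congr_ae (Filter.Eventually.of_forall fun v => ?_)
  simp only [smul_eq_mul]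
  rw [ENNReal.toReal_ofReal (by positivity)]
  ring

theorem gaussSmooth_eq_integral {d : ℕ} (f : EuclideanSpace ℝ (Fin d) → ℝ) (σ : ℝ)
    (x : EuclideanSpace ℝ (Fin d)) :
    gaussSmooth f σ x = ∫ v, f (x + σ • v) ∂samplingMeasure d :=
  (integral_samplingMeasure _).symm

instance isProbabilityMeasure_samplingMeasure (d : ℕ) :
    IsProbabilityMeasure (samplingMeasure d) := by
  have hI : Integrable (fun _ : EuclideanSpace ℝ (Fin d) => (1 : ℝ)) (samplingMeasure d) := by
    rw [integrable_samplingMeasure_iff]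
    simpa using integrable_norm_pow_mul_exp_neg_norm_sq d 0
  have : IsFiniteMeasure (samplingMeasure d) := by
    simpa [integrable_const_iff] using hI
  have h := integral_samplingMeasure (d := d) fun _ => 1
  have h2 := GaussianFourier.integral_rexp_neg_mul_sq_norm
    (V := EuclideanSpace ℝ (Fin d)) (b := 1) one_pos
  simp only [neg_mul, one_mul, div_one, finrank_euclideanSpace, Fintype.card_fin] at h2
  simp only [one_mul, h2] at h
  rw [one_div, inv_mul_cancel₀ (by positivity)] at h
  rw [integral_const, smul_eq_mul, mul_one] at h
  exact ⟨(ENNReal.toReal_eq_one_iff _).1 h⟩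

theorem integrable_norm_pow (d m : ℕ) :
    Integrable (fun v : EuclideanSpace ℝ (Fin d) => ‖v‖ ^ m) (samplingMeasure d) :=
  integrable_samplingMeasure_iff.2 (integrable_norm_pow_mul_exp_neg_norm_sq d m)

theorem Continuous.integrable_samplingMeasure {d : ℕ} {h : EuclideanSpace ℝ (Fin d) → ℝ}
    (hc : Continuous h) (C : ℝ) (m : ℕ) (hb : ∀ v, |h v| ≤ C * ‖v‖ ^ m) :
    Integrable h (samplingMeasure d) :=
  ((integrable_norm_pow d m).const_mul C).mono' hc.aestronglyMeasurable
    (Filter.Eventually.of_forall hb)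

theorem hasFDerivAt_norm_sq {d : ℕ} (v : EuclideanSpace ℝ (Fin d)) :
    HasFDerivAt (fun v : EuclideanSpace ℝ (Fin d) => ‖v‖ ^ 2) ((2 : ℝ) • innerSL ℝ v) v :=
  (hasStrictFDerivAt_norm_sq v).hasFDerivAt.congr_fderiv (by ext w; simp)

/-- Stein's identity for the covariance `(1/2) I`: integration by parts against `exp (-‖v‖²)`. -/
theorem two_mul_integral_mul_inner_eq {d : ℕ} {h : EuclideanSpace ℝ (Fin d) → ℝ}
    (hd : Differentiable ℝ h) (a : EuclideanSpace ℝ (Fin d))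
    (h1 : Integrable h (samplingMeasure d))
    (h2 : Integrable (fun v => fderiv ℝ h v a) (samplingMeasure d))
    (h3 : Integrable (fun v => h v * ⟪v, a⟫) (samplingMeasure d)) :
    2 * ∫ v, h v * ⟪v, a⟫ ∂samplingMeasure d = ∫ v, fderiv ℝ h v a ∂samplingMeasure d := by
  have hg : ∀ v : EuclideanSpace ℝ (Fin d), HasFDerivAt (fun v => Real.exp (-‖v‖ ^ 2))
      (Real.exp (-‖v‖ ^ 2) • -((2 : ℝ) • innerSL ℝ v)) v := fun v =>
    (hasFDerivAt_norm_sq v).neg.exp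
  have hg' : ∀ v : EuclideanSpace ℝ (Fin d), fderiv ℝ (fun v => Real.exp (-‖v‖ ^ 2)) v a =
      -2 * ⟪v, a⟫ * Real.exp (-‖v‖ ^ 2) := fun v => by
    rw [(hg v).fderiv]; simp; ring
  rw [integrable_samplingMeasure_iff] at h1 h2 h3
  have key := integral_mul_fderiv_eq_neg_fderiv_mul_of_integrable (μ := volume) (f := h)
    (g := fun v => Real.exp (-‖v‖ ^ 2)) (v := a) h2
    (by simp only [hg']; exact (h3.const_mul (-2)).congr
          (Filter.Eventually.of_forall fun v => by ring)) h1
    (fun v _ => hd v) (fun v _ => (hg v).differentiableAt)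
  simp only [hg'] at key
  have e : ∫ v, h v * (-2 * ⟪v, a⟫ * Real.exp (-‖v‖ ^ 2)) =
      -2 * ∫ v, h v * ⟪v, a⟫ * Real.exp (-‖v‖ ^ 2) := by
    rw [← integral_const_mul]
    congr 1
    ext v; ring
  rw [integral_samplingMeasure, integral_samplingMeasure]
  linear_combination (1 / Real.pi ^ ((d : ℝ) / 2)) * (e - key)

theorem integral_inner_samplingMeasure {d : ℕ} (a : EuclideanSpace ℝ (Fin d)) :
    ∫ v, ⟪a, v⟫ ∂samplingMeasure d = 0 := by
  have h := two_mul_integral_mul_inner_eq (h := fun _ => 1) (by fun_prop) a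
    (integrable_const _) (by simp) (Continuous.integrable_samplingMeasure (by fun_prop) ‖a‖ 1
      fun v => by
        rw [one_mul, pow_one, mul_comm]; exact abs_real_inner_le_norm v a)
  simp only [one_mul, fderiv_fun_const, Pi.zero_apply, zero_apply,
    integral_zero] at h
  simp only [real_inner_comm _ a]
  linarith

theorem integrable_inner_sq_mul_norm_pow {d : ℕ} (a : EuclideanSpace ℝ (Fin d)) (m : ℕ) :
    Integrable (fun v => ⟪a, v⟫ ^ 2 * ‖v‖ ^ m) (samplingMeasure d) := by
  refine Continuous.integrable_samplingMeasure (by fun_prop) (‖a‖ ^ 2) (m + 2) fun v => ?_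
  rw [abs_of_nonneg (by positivity)]
  calc ⟪a, v⟫ ^ 2 * ‖v‖ ^ m ≤ (‖a‖ * ‖v‖) ^ 2 * ‖v‖ ^ m := by
        rw [← sq_abs]; gcongr; exact abs_real_inner_le_norm a v
    _ = _ := by ring

/-- Integration by parts applied to `v ↦ ⟪a, v⟫ ‖v‖ ^ (2 m)`: a recursion for the moments. For `m = 0`
the truncated exponent `m - 1` is harmless, since the last term carries the factor `m`. -/
theorem integral_inner_sq_mul_norm_pow_rec {d : ℕ} (a : EuclideanSpace ℝ (Fin d)) (m : ℕ) :
    2 * ∫ v, ⟪a, v⟫ ^ 2 * ‖v‖ ^ (2 * m) ∂samplingMeasure d =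
      ‖a‖ ^ 2 * ∫ v, ‖v‖ ^ (2 * m) ∂samplingMeasure d +
        2 * m * ∫ v, ⟪a, v⟫ ^ 2 * ‖v‖ ^ (2 * (m - 1)) ∂samplingMeasure d := by
  have hD : ∀ v : EuclideanSpace ℝ (Fin d), HasFDerivAt (fun v => ⟪a, v⟫ * (‖v‖ ^ 2) ^ m)
      (⟪a, v⟫ • ((m * (‖v‖ ^ 2) ^ (m - 1)) • ((2 : ℝ) • innerSL ℝ v)) +
        ((‖v‖ ^ 2) ^ m) • innerSL ℝ a) v := fun v =>
    ((innerSL ℝ a).hasFDerivAt.mul ((hasFDerivAt_norm_sq v).pow m)).congr_fderiv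
      (by ext w; simp)
  have hD' : ∀ v : EuclideanSpace ℝ (Fin d), fderiv ℝ (fun v => ⟪a, v⟫ * (‖v‖ ^ 2) ^ m) v a =
      ‖a‖ ^ 2 * ‖v‖ ^ (2 * m) + 2 * m * (⟪a, v⟫ ^ 2 * ‖v‖ ^ (2 * (m - 1))) := fun v => by
    rw [(hD v).fderiv]
    simp [real_inner_comm a v, pow_mul]
    ring
  have i1 := ((integrable_norm_pow d (2 * m)).const_mul (‖a‖ ^ 2))
  have i2 := (integrable_inner_sq_mul_norm_pow a (2 * (m - 1))).const_mul (2 * (m : ℝ))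
  have e3 : ∀ v : EuclideanSpace ℝ (Fin d), ⟪a, v⟫ * (‖v‖ ^ 2) ^ m * ⟪v, a⟫ =
      ⟪a, v⟫ ^ 2 * ‖v‖ ^ (2 * m) := fun v => by
    rw [real_inner_comm a v, pow_mul]; ring
  have key := two_mul_integral_mul_inner_eq (h := fun v => ⟪a, v⟫ * (‖v‖ ^ 2) ^ m)
    (fun v => (hD v).differentiableAt) a
    (Continuous.integrable_samplingMeasure (by fun_prop) ‖a‖ (2 * m + 1) fun v => by
      rw [abs_mul, abs_of_nonneg (by positivity : 0 ≤ (‖v‖ ^ 2) ^ m), ← pow_mul]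
      calc |⟪a, v⟫| * ‖v‖ ^ (2 * m) ≤ (‖a‖ * ‖v‖) * ‖v‖ ^ (2 * m) := by
            gcongr; exact abs_real_inner_le_norm a v
        _ = _ := by ring)
    (by simp only [hD']; exact i1.add i2)
    (by simp only [e3]; exact integrable_inner_sq_mul_norm_pow a (2 * m))
  simp only [hD', e3] at key
  rw [key, integral_add i1 i2, integral_const_mul, integral_const_mul]

/-- Summing the mixed moments over an orthonormal basis raises the power of the norm by two. -/
theorem sum_integral_basis_inner_sq (d m : ℕ) :
    ∑ i, ∫ v, ⟪EuclideanSpace.basisFun (Fin d) ℝ i, v⟫ ^ 2 * ‖v‖ ^ m ∂samplingMeasure d =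
      ∫ v, ‖v‖ ^ (m + 2) ∂samplingMeasure d := by
  rw [← integral_finsetSum _ fun i _ => integrable_inner_sq_mul_norm_pow _ m]
  congr 1
  ext v
  rw [← Finset.sum_mul, OrthonormalBasis.sum_sq_inner_right]
  ring

theorem integral_inner_sq {d : ℕ} (a : EuclideanSpace ℝ (Fin d)) :
    ∫ v, ⟪a, v⟫ ^ 2 ∂samplingMeasure d = ‖a‖ ^ 2 / 2 := by
  have := integral_inner_sq_mul_norm_pow_rec a 0
  simp at this
  linarith

theorem integral_norm_sq (d : ℕ) : ∫ v, ‖v‖ ^ 2 ∂samplingMeasure d = (d : ℝ) / 2 := by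
  have := sum_integral_basis_inner_sq d 0
  simp only [pow_zero, mul_one, integral_inner_sq, OrthonormalBasis.norm_eq_one] at this
  simp at this
  rw [← this]; ring

theorem integral_inner_sq_mul_norm_sq {d : ℕ} (a : EuclideanSpace ℝ (Fin d)) :
    ∫ v, ⟪a, v⟫ ^ 2 * ‖v‖ ^ 2 ∂samplingMeasure d = ((d : ℝ) + 2) / 4 * ‖a‖ ^ 2 := by
  have := integral_inner_sq_mul_norm_pow_rec a 1
  simp [integral_norm_sq, integral_inner_sq] at this
  linarith

theorem integral_norm_pow_four (d : ℕ) :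
    ∫ v, ‖v‖ ^ 4 ∂samplingMeasure d = (d : ℝ) * (d + 2) / 4 := by
  have := sum_integral_basis_inner_sq d 2
  simp only [integral_inner_sq_mul_norm_sq, OrthonormalBasis.norm_eq_one] at this
  simp at this
  rw [← this]; ring

theorem integral_norm_pow_six (d : ℕ) :
    ∫ v, ‖v‖ ^ 6 ∂samplingMeasure d = (d : ℝ) * (d + 2) * (d + 4) / 8 := by
  have h : ∀ a : EuclideanSpace ℝ (Fin d), ∫ v, ⟪a, v⟫ ^ 2 * ‖v‖ ^ 4 ∂samplingMeasure d =
      ((d : ℝ) + 2) * (d + 4) / 8 * ‖a‖ ^ 2 := fun a => by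
    have := integral_inner_sq_mul_norm_pow_rec a 2
    norm_num [integral_norm_pow_four, integral_inner_sq_mul_norm_sq] at this
    linarith
  have := sum_integral_basis_inner_sq d 4
  simp only [h, OrthonormalBasis.norm_eq_one] at this
  simp at this
  rw [← this]; ring

/-! ### One step of the iteration, for fixed samples -/

theorem LSmooth.continuous_gradient {d : ℕ} {L : ℝ} {f : EuclideanSpace ℝ (Fin d) → ℝ}
    (hf : LSmooth L f) : Continuous (∇ f) := by
  refine (LipschitzWith.of_dist_le_mul (K := L.toNNReal) fun x y => ?_).continuous
  rw [dist_eq_norm, dist_eq_norm]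
  exact (hf.2 x y).trans (by gcongr; exact Real.le_coe_toNNReal L)

/-- The first-order Taylor remainder of an `L`-smooth function is at most `L ‖h‖² / 2`. -/
theorem LSmooth.abs_sub_sub_inner_le {d : ℕ} {L : ℝ} {f : EuclideanSpace ℝ (Fin d) → ℝ}
    (hf : LSmooth L f) (x h : EuclideanSpace ℝ (Fin d)) :
    |f (x + h) - f x - ⟪∇ f x, h⟫| ≤ L / 2 * ‖h‖ ^ 2 := by
  have hline : ∀ s : ℝ, HasDerivAt (fun s : ℝ => f (x + s • h) - f x - s * ⟪∇ f x, h⟫)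
      ⟪∇ f (x + s • h) - ∇ f x, h⟫ s := fun s => by
    have h1 : HasDerivAt (fun s : ℝ => x + s • h) h s := by
      simpa using ((hasDerivAt_id s).smul_const h).const_add x
    have h2 := (hf.1 (x + s • h)).hasGradientAt.hasFDerivAt.comp_hasDerivAt s h1
    have h3 := (h2.sub_const (f x)).sub ((hasDerivAt_id s).mul_const ⟪∇ f x, h⟫)
    refine h3.congr_deriv ?_
    simp [inner_sub_left]
  have key := image_norm_le_of_norm_deriv_right_le_deriv_boundary (a := 0) (b := 1)
    (f := fun s : ℝ => f (x + s • h) - f x - s * ⟪∇ f x, h⟫)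
    (f' := fun s => ⟪∇ f (x + s • h) - ∇ f x, h⟫)
    (B := fun s => L / 2 * ‖h‖ ^ 2 * s ^ 2) (B' := fun s => L * ‖h‖ ^ 2 * s)
    (fun s _ => (hline s).continuousAt.continuousWithinAt)
    (fun s _ => (hline s).hasDerivWithinAt) (by simp)
    (fun s => ((hasDerivAt_pow 2 s).const_mul _).congr_deriv (by norm_num; ring))
    (fun s hs => by
      rw [Real.norm_eq_abs]
      refine (abs_real_inner_le_norm _ _).trans ?_
      have h1 := hf.2 (x + s • h) x
      rw [add_sub_cancel_left, norm_smul, Real.norm_of_nonneg hs.1] at h1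
      nlinarith [norm_nonneg h])
    (Set.right_mem_Icc.2 zero_le_one)
  simpa using key

theorem LSmooth.abs_forwardDiff_sub_le {d : ℕ} {L : ℝ} {f : EuclideanSpace ℝ (Fin d) → ℝ}
    (hf : LSmooth L f) {s : ℝ} (hs : 0 < s) (x v : EuclideanSpace ℝ (Fin d)) :
    |forwardDiff f s x v - 2 * ⟪∇ f x, v⟫| ≤ L * s * ‖v‖ ^ 2 := by
  have h := hf.abs_sub_sub_inner_le x (s • v)
  rw [norm_smul, Real.norm_of_nonneg hs.le, inner_smul_right] at h
  have e : forwardDiff f s x v - 2 * ⟪∇ f x, v⟫ =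
      (f (x + s • v) - f x - s * ⟪∇ f x, v⟫) / (s / 2) := by
    rw [forwardDiff]; field_simp
  rw [e, abs_div, abs_of_pos (half_pos hs), div_le_iff₀ (half_pos hs)]
  linarith

theorem LSmooth.abs_centralDiff_sub_le {d : ℕ} {L : ℝ} {f : EuclideanSpace ℝ (Fin d) → ℝ}
    (hf : LSmooth L f) {s : ℝ} (hs : 0 < s) (x v : EuclideanSpace ℝ (Fin d)) :
    |centralDiff f s x v - 2 * ⟪∇ f x, v⟫| ≤ L * s * ‖v‖ ^ 2 := by
  have h := hf.abs_sub_sub_inner_le x (s • v)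
  have h' := hf.abs_sub_sub_inner_le x (-(s • v))
  rw [norm_neg, inner_neg_right, ← sub_eq_add_neg] at h'
  rw [norm_smul, Real.norm_of_nonneg hs.le, inner_smul_right] at h h'
  have e : centralDiff f s x v - 2 * ⟪∇ f x, v⟫ =
      ((f (x + s • v) - f x - s * ⟪∇ f x, v⟫) -
        (f (x - s • v) - f x - -(s * ⟪∇ f x, v⟫))) / s := by
    rw [centralDiff]; field_simp; ring
  rw [e, abs_div, abs_of_pos hs, div_le_iff₀ hs]
  refine (abs_sub _ _).trans ?_
  linarith

/-- Jensen's inequality for the average of the `N` samples. No independence between them is used. -/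
theorem norm_mcGradient_sq_le {d N : ℕ}
    (δ : ℝ → EuclideanSpace ℝ (Fin d) → EuclideanSpace ℝ (Fin d) → ℝ)
    (s : ℝ) (x : EuclideanSpace ℝ (Fin d)) (u : Fin N → EuclideanSpace ℝ (Fin d)) :
    ‖mcGradient δ s x u‖ ^ 2 ≤ 1 / (N : ℝ) * ∑ n, δ s x (u n) ^ 2 * ‖u n‖ ^ 2 := by
  rcases N.eq_zero_or_pos with rfl | hN
  · simp [mcGradient]
  have hN' : (0 : ℝ) < N := by exact_mod_cast hN
  have h1 := norm_sum_le Finset.univ fun n => δ s x (u n) • u n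
  have h2 := sq_sum_le_card_mul_sum_sq (s := Finset.univ) (f := fun n => ‖δ s x (u n) • u n‖)
  simp only [Finset.card_univ, Fintype.card_fin, norm_smul, mul_pow, Real.norm_eq_abs,
    sq_abs] at h1 h2
  have h3 := pow_le_pow_left₀ (norm_nonneg _) h1 2
  rw [mcGradient, norm_smul, mul_pow, Real.norm_of_nonneg (by positivity)]
  calc (1 / (N : ℝ)) ^ 2 * ‖∑ n, δ s x (u n) • u n‖ ^ 2
      ≤ (1 / (N : ℝ)) ^ 2 * (N * ∑ n, δ s x (u n) ^ 2 * ‖u n‖ ^ 2) := by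
        gcongr; exact h3.trans h2
    _ = _ := by field_simp

/-- Upper bound for `‖D • v‖²` when `D` is within `L s ‖v‖²` of `2 ⟪a, v⟫`; here `a` stands for the
gradient of an `L`-smooth function and `D` for a finite difference of it with step `s`. -/
noncomputable def secondMomentBound {d : ℕ} (L s : ℝ) (a v : EuclideanSpace ℝ (Fin d)) : ℝ :=
  8 * (⟪a, v⟫ ^ 2 * ‖v‖ ^ 2) + 2 * (L * s) ^ 2 * ‖v‖ ^ 6

/-- Upper bound for the contribution of one sample `v` to the change of `f` in a step of size `t`
from a point with gradient `a`, for finite differences with smoothing parameter `s`. -/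
noncomputable def decreaseBound {d : ℕ} (L t s : ℝ) (a v : EuclideanSpace ℝ (Fin d)) : ℝ :=
  -(3 / 2 * t) * ⟪a, v⟫ ^ 2 + t * (L * s) ^ 2 / 2 * ‖v‖ ^ 4 +
    L * t ^ 2 / 2 * secondMomentBound L s a v

theorem sq_mul_norm_sq_le_secondMomentBound {d : ℕ} {L s D : ℝ}
    {a v : EuclideanSpace ℝ (Fin d)} (hD : |D - 2 * ⟪a, v⟫| ≤ L * s * ‖v‖ ^ 2) :
    D ^ 2 * ‖v‖ ^ 2 ≤ secondMomentBound L s a v := by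
  have h := sq_le_sq' (by linarith [neg_abs_le (D - 2 * ⟪a, v⟫)]) ((le_abs_self _).trans hD)
  have h2 : D ^ 2 ≤ 8 * ⟪a, v⟫ ^ 2 + 2 * (L * s * ‖v‖ ^ 2) ^ 2 := by
    nlinarith [sq_nonneg (D - 4 * ⟪a, v⟫)]
  calc D ^ 2 * ‖v‖ ^ 2 ≤ (8 * ⟪a, v⟫ ^ 2 + 2 * (L * s * ‖v‖ ^ 2) ^ 2) * ‖v‖ ^ 2 := by gcongr
    _ = secondMomentBound L s a v := by rw [secondMomentBound]; ring

theorem le_inner_mul_of_abs_sub_le {d : ℕ} {L s D : ℝ}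
    {a v : EuclideanSpace ℝ (Fin d)} (hD : |D - 2 * ⟪a, v⟫| ≤ L * s * ‖v‖ ^ 2) :
    3 / 2 * ⟪a, v⟫ ^ 2 - (L * s) ^ 2 / 2 * ‖v‖ ^ 4 ≤ D * ⟪a, v⟫ := by
  have h := sq_le_sq' (by linarith [neg_abs_le (D - 2 * ⟪a, v⟫)]) ((le_abs_self _).trans hD)
  nlinarith [sq_nonneg (D - ⟪a, v⟫)]

theorem LSmooth.norm_gradient_step_sq_le {d N : ℕ} {L : ℝ} {f : EuclideanSpace ℝ (Fin d) → ℝ}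
    (hf : LSmooth L f) {δ : ℝ → EuclideanSpace ℝ (Fin d) → EuclideanSpace ℝ (Fin d) → ℝ}
    {s : ℝ} (hδ : ∀ x v, |δ s x v - 2 * ⟪∇ f x, v⟫| ≤ L * s * ‖v‖ ^ 2) (t : ℝ)
    (x : EuclideanSpace ℝ (Fin d)) (u : Fin N → EuclideanSpace ℝ (Fin d)) :
    ‖∇ f (x - t • mcGradient δ s x u)‖ ^ 2 ≤ 2 * ‖∇ f x‖ ^ 2 +
      2 * (L * t) ^ 2 * (1 / (N : ℝ) * ∑ n, secondMomentBound L s (∇ f x) (u n)) := by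
  have h1 := hf.2 (x - t • mcGradient δ s x u) x
  rw [sub_sub_cancel_left, norm_neg, norm_smul, Real.norm_eq_abs] at h1
  have h2 := norm_sub_norm_le (∇ f (x - t • mcGradient δ s x u)) (∇ f x)
  have h3 : ‖∇ f (x - t • mcGradient δ s x u)‖ ^ 2 ≤
      (‖∇ f x‖ + L * (|t| * ‖mcGradient δ s x u‖)) ^ 2 := by
    gcongr; linarith
  have h4 := norm_mcGradient_sq_le δ s x u
  have h5 : ∑ n, δ s x (u n) ^ 2 * ‖u n‖ ^ 2 ≤ ∑ n, secondMomentBound L s (∇ f x) (u n) :=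
    Finset.sum_le_sum fun n _ => sq_mul_norm_sq_le_secondMomentBound (hδ x (u n))
  calc _ ≤ (‖∇ f x‖ + L * (|t| * ‖mcGradient δ s x u‖)) ^ 2 := h3
    _ ≤ 2 * ‖∇ f x‖ ^ 2 + 2 * (L * |t|) ^ 2 * ‖mcGradient δ s x u‖ ^ 2 := by
      nlinarith [sq_nonneg (‖∇ f x‖ - L * (|t| * ‖mcGradient δ s x u‖))]
    _ = 2 * ‖∇ f x‖ ^ 2 + 2 * (L * t) ^ 2 * ‖mcGradient δ s x u‖ ^ 2 := by
      rw [mul_pow, mul_pow, sq_abs]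
    _ ≤ _ := by
      gcongr
      exact h4.trans (by gcongr)

/-- One step changes `f` by at most an average of terms in which `δ` no longer occurs: each is a
polynomial in the gradient at the current point and one sample. -/
theorem LSmooth.step_le {d N : ℕ} (hN : 1 ≤ N) {L : ℝ} (hL : 0 ≤ L)
    {f : EuclideanSpace ℝ (Fin d) → ℝ}
    (hf : LSmooth L f) {δ : ℝ → EuclideanSpace ℝ (Fin d) → EuclideanSpace ℝ (Fin d) → ℝ}
    {s : ℝ} (hδ : ∀ x v, |δ s x v - 2 * ⟪∇ f x, v⟫| ≤ L * s * ‖v‖ ^ 2) {t : ℝ} (ht : 0 ≤ t)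
    (x : EuclideanSpace ℝ (Fin d)) (u : Fin N → EuclideanSpace ℝ (Fin d)) :
    f (x - t • mcGradient δ s x u) ≤
      f x + 1 / (N : ℝ) * ∑ n, decreaseBound L t s (∇ f x) (u n) := by
  have h1 := le_of_abs_le (hf.abs_sub_sub_inner_le x (-(t • mcGradient δ s x u)))
  rw [norm_neg, norm_smul, inner_neg_right, inner_smul_right, ← sub_eq_add_neg,
    Real.norm_of_nonneg ht, mul_pow] at h1
  have h2 := norm_mcGradient_sq_le δ s x u
  have h3 : ⟪∇ f x, mcGradient δ s x u⟫ = 1 / (N : ℝ) * ∑ n, δ s x (u n) * ⟪∇ f x, u n⟫ := by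
    simp [mcGradient, inner_smul_right, inner_sum]
  have h4 : 1 / (N : ℝ) * ∑ n, (-t * (δ s x (u n) * ⟪∇ f x, u n⟫) +
      L * t ^ 2 / 2 * (δ s x (u n) ^ 2 * ‖u n‖ ^ 2)) ≤
      1 / (N : ℝ) * ∑ n, decreaseBound L t s (∇ f x) (u n) := by
    gcongr with n
    rw [decreaseBound]
    have e1 := mul_le_mul_of_nonneg_left (le_inner_mul_of_abs_sub_le (hδ x (u n))) ht
    have e2 := mul_le_mul_of_nonneg_left (sq_mul_norm_sq_le_secondMomentBound (hδ x (u n)))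
      (by positivity : 0 ≤ L * t ^ 2 / 2)
    linarith
  rw [Finset.sum_add_distrib, ← Finset.mul_sum, ← Finset.mul_sum] at h4
  have h5 := mul_le_mul_of_nonneg_left h2 (by positivity : 0 ≤ L * t ^ 2 / 2)
  rw [h3] at h1
  linarith

/-! ### The smoothed function -/

theorem LSmooth.abs_remainder_smul_le {d : ℕ} {L : ℝ} {f : EuclideanSpace ℝ (Fin d) → ℝ}
    (hf : LSmooth L f) (s : ℝ) (x v : EuclideanSpace ℝ (Fin d)) :
    |f (x + s • v) - f x - s * ⟪∇ f x, v⟫| ≤ L / 2 * s ^ 2 * ‖v‖ ^ 2 := by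
  have h := hf.abs_sub_sub_inner_le x (s • v)
  rwa [norm_smul, inner_smul_right, mul_pow, Real.norm_eq_abs, sq_abs, ← mul_assoc] at h

theorem integrable_inner {d : ℕ} (a : EuclideanSpace ℝ (Fin d)) :
    Integrable (fun v => ⟪a, v⟫) (samplingMeasure d) :=
  Continuous.integrable_samplingMeasure (by fun_prop) ‖a‖ 1 fun v => by
    rw [pow_one]; exact abs_real_inner_le_norm a v

theorem LSmooth.integrable_remainder {d : ℕ} {L : ℝ} {f : EuclideanSpace ℝ (Fin d) → ℝ}
    (hf : LSmooth L f) (s : ℝ) (x : EuclideanSpace ℝ (Fin d)) :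
    Integrable (fun v => f (x + s • v) - f x - s * ⟪∇ f x, v⟫) (samplingMeasure d) := by
  have hc := hf.1.continuous
  exact Continuous.integrable_samplingMeasure (by fun_prop) (L / 2 * s ^ 2) 2
    (hf.abs_remainder_smul_le s x)

theorem LSmooth.integrable_shift {d : ℕ} {L : ℝ} {f : EuclideanSpace ℝ (Fin d) → ℝ}
    (hf : LSmooth L f) (s : ℝ) (x : EuclideanSpace ℝ (Fin d)) :
    Integrable (fun v => f (x + s • v)) (samplingMeasure d) := by
  refine ((hf.integrable_remainder s x).add
    ((integrable_const (f x)).add ((integrable_inner (∇ f x)).const_mul s))).congr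
    (Filter.Eventually.of_forall fun v => ?_)
  simp only [Pi.add_apply]
  ring

/-- The linear term of the Taylor expansion integrates to zero, so smoothing moves `f` by `O(s²)`. -/
theorem LSmooth.abs_gaussSmooth_sub_le {d : ℕ} {L : ℝ} {f : EuclideanSpace ℝ (Fin d) → ℝ}
    (hf : LSmooth L f) (s : ℝ) (x : EuclideanSpace ℝ (Fin d)) :
    |gaussSmooth f s x - f x| ≤ L * d / 4 * s ^ 2 := by
  have e : gaussSmooth f s x - f x =
      ∫ v, (f (x + s • v) - f x - s * ⟪∇ f x, v⟫) ∂samplingMeasure d := by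
    have i1 := hf.integrable_shift s x
    rw [integral_sub (f := fun v => f (x + s • v) - f x) (i1.sub (integrable_const _))
        ((integrable_inner _).const_mul s),
      integral_sub i1 (integrable_const _), integral_const_mul, integral_inner_samplingMeasure,
      ← gaussSmooth_eq_integral]
    simp
  rw [e]
  calc _ ≤ ∫ v, |f (x + s • v) - f x - s * ⟪∇ f x, v⟫| ∂samplingMeasure d :=
        abs_integral_le_integral_abs
    _ ≤ ∫ v, L / 2 * s ^ 2 * ‖v‖ ^ 2 ∂samplingMeasure d :=
        integral_mono (hf.integrable_remainder s x).abs
          ((integrable_norm_pow d 2).const_mul _) (hf.abs_remainder_smul_le s x)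
    _ = _ := by rw [integral_const_mul, integral_norm_sq]; ring

theorem LSmooth.measurable_gaussSmooth {d : ℕ} {L : ℝ} {f : EuclideanSpace ℝ (Fin d) → ℝ}
    (hf : LSmooth L f) (s : ℝ) : Measurable (gaussSmooth f s) := by
  have hc := hf.1.continuous
  have h : StronglyMeasurable fun p : EuclideanSpace ℝ (Fin d) × EuclideanSpace ℝ (Fin d) =>
      f (p.1 + s • p.2) :=
    (by fun_prop : Continuous _).stronglyMeasurable
  have := h.integral_prod_right' (ν := samplingMeasure d)
  rw [funext (gaussSmooth_eq_integral f s)]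
  exact this.measurable

/-! ### Expectations over independent Gaussian samples -/

section IndependentGaussian

variable {d : ℕ} {Ω : Type*} [MeasurableSpace Ω] {P : Measure Ω}
  {X U : Ω → EuclideanSpace ℝ (Fin d)}

theorem integrable_norm_pow_of_hasLaw (hU : HasLaw U (samplingMeasure d) P) (m : ℕ) :
    Integrable (fun ω => ‖U ω‖ ^ m) P := by
  have h := integrable_norm_pow d m
  rw [← hU.map_eq] at h
  exact h.comp_aemeasurable hU.aemeasurable

theorem integral_norm_pow_of_hasLaw (hU : HasLaw U (samplingMeasure d) P) (m : ℕ) :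
    ∫ ω, ‖U ω‖ ^ m ∂P = ∫ v, ‖v‖ ^ m ∂samplingMeasure d := by
  rw [← hU.map_eq, integral_map hU.aemeasurable (by fun_prop)]

/-- Independence makes the product `‖X‖² ‖U‖ ^ (m + 2)`, which dominates, integrable. -/
theorem integrable_inner_sq_mul_norm_pow_of_indepFun (hX : Measurable X)
    (hU : HasLaw U (samplingMeasure d) P) (hXU : IndepFun X U P)
    (hX2 : Integrable (fun ω => ‖X ω‖ ^ 2) P) (m : ℕ) :
    Integrable (fun ω => ⟪X ω, U ω⟫ ^ 2 * ‖U ω‖ ^ m) P := by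
  have hUm := hU.aemeasurable
  have h := (hXU.comp (φ := fun v => ‖v‖ ^ 2) (ψ := fun v => ‖v‖ ^ (m + 2)) (by fun_prop)
    (by fun_prop)).integrable_mul hX2 (integrable_norm_pow_of_hasLaw hU (m + 2))
  refine h.mono' (AEMeasurable.aestronglyMeasurable (by fun_prop))
    (Filter.Eventually.of_forall fun ω => ?_)
  rw [Real.norm_of_nonneg (by positivity)]
  simp only [Pi.mul_apply, Function.comp_apply]
  calc ⟪X ω, U ω⟫ ^ 2 * ‖U ω‖ ^ m ≤ (‖X ω‖ * ‖U ω‖) ^ 2 * ‖U ω‖ ^ m := by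
        rw [← sq_abs]; gcongr; exact abs_real_inner_le_norm _ _
    _ = _ := by ring

theorem integrable_secondMomentBound (hX : Measurable X)
    (hU : HasLaw U (samplingMeasure d) P) (hXU : IndepFun X U P)
    (hX2 : Integrable (fun ω => ‖X ω‖ ^ 2) P) (L s : ℝ) :
    Integrable (fun ω => secondMomentBound L s (X ω) (U ω)) P :=
  ((integrable_inner_sq_mul_norm_pow_of_indepFun hX hU hXU hX2 2).const_mul 8).add
    ((integrable_norm_pow_of_hasLaw hU 6).const_mul _)

theorem integrable_decreaseBound (hX : Measurable X)
    (hU : HasLaw U (samplingMeasure d) P) (hXU : IndepFun X U P)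
    (hX2 : Integrable (fun ω => ‖X ω‖ ^ 2) P) (L t s : ℝ) :
    Integrable (fun ω => decreaseBound L t s (X ω) (U ω)) P := by
  have h := integrable_inner_sq_mul_norm_pow_of_indepFun hX hU hXU hX2 0
  simp only [pow_zero, mul_one] at h
  exact ((h.const_mul _).add ((integrable_norm_pow_of_hasLaw hU 4).const_mul _)).add
    ((integrable_secondMomentBound hX hU hXU hX2 L s).const_mul _)

variable [IsProbabilityMeasure P]

/-- By Fubini, a Gaussian moment that is a multiple of `‖a‖²` for every deterministic `a` keeps its
constant when `a` is replaced by an independent random vector `X`. -/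
theorem integral_inner_sq_mul_norm_pow_of_indepFun (hX : Measurable X)
    (hU : HasLaw U (samplingMeasure d) P) (hXU : IndepFun X U P)
    (hX2 : Integrable (fun ω => ‖X ω‖ ^ 2) P) {m : ℕ} {c : ℝ}
    (hc : ∀ a, ∫ v, ⟪a, v⟫ ^ 2 * ‖v‖ ^ m ∂samplingMeasure d = c * ‖a‖ ^ 2) :
    ∫ ω, ⟪X ω, U ω⟫ ^ 2 * ‖U ω‖ ^ m ∂P = c * ∫ ω, ‖X ω‖ ^ 2 ∂P := by
  have hUm := hU.aemeasurable
  have hmap := (indepFun_iff_map_prod_eq_prod_map_map hX.aemeasurable hUm).1 hXU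
  rw [hU.map_eq] at hmap
  have hpair : AEMeasurable (fun ω => (X ω, U ω)) P := hX.aemeasurable.prodMk hUm
  let F : EuclideanSpace ℝ (Fin d) × EuclideanSpace ℝ (Fin d) → ℝ :=
    fun p => ⟪p.1, p.2⟫ ^ 2 * ‖p.2‖ ^ m
  have hF : Continuous F := by fun_prop
  have hint : Integrable F ((P.map X).prod (samplingMeasure d)) := by
    rw [← hmap, integrable_map_measure hF.aestronglyMeasurable hpair]
    exact integrable_inner_sq_mul_norm_pow_of_indepFun hX hU hXU hX2 m
  calc ∫ ω, ⟪X ω, U ω⟫ ^ 2 * ‖U ω‖ ^ m ∂P = ∫ p, F p ∂((P.map X).prod (samplingMeasure d)) := by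
        rw [← hmap, integral_map hpair hF.aestronglyMeasurable]
    _ = ∫ a, c * ‖a‖ ^ 2 ∂(P.map X) := by
        rw [integral_prod _ hint]
        simp only [F, hc]
    _ = _ := by rw [integral_const_mul, integral_map hX.aemeasurable (by fun_prop)]

theorem integral_secondMomentBound (hX : Measurable X)
    (hU : HasLaw U (samplingMeasure d) P) (hXU : IndepFun X U P)
    (hX2 : Integrable (fun ω => ‖X ω‖ ^ 2) P) (L s : ℝ) :
    ∫ ω, secondMomentBound L s (X ω) (U ω) ∂P = 2 * (d + 2) * ∫ ω, ‖X ω‖ ^ 2 ∂P +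
      (L * s) ^ 2 * (d * (d + 2) * (d + 4) / 4) := by
  simp only [secondMomentBound]
  rw [integral_add ((integrable_inner_sq_mul_norm_pow_of_indepFun hX hU hXU hX2 2).const_mul 8)
    ((integrable_norm_pow_of_hasLaw hU 6).const_mul _), integral_const_mul, integral_const_mul,
    integral_inner_sq_mul_norm_pow_of_indepFun hX hU hXU hX2 integral_inner_sq_mul_norm_sq,
    integral_norm_pow_of_hasLaw hU, integral_norm_pow_six]
  ring

/-- The step size bound `2 L t (d + 4) ≤ 1` leaves a decrease of at least a quarter of `t` times the
mean squared gradient, and keeps the error of order `s²` below `L d s² / 4`. -/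
theorem integral_decreaseBound_le (hX : Measurable X)
    (hU : HasLaw U (samplingMeasure d) P) (hXU : IndepFun X U P)
    (hX2 : Integrable (fun ω => ‖X ω‖ ^ 2) P) {L t : ℝ} (hL : 0 ≤ L) (ht : 0 ≤ t)
    (htL : 2 * (L * t) * (d + 4) ≤ 1) (s : ℝ) :
    ∫ ω, decreaseBound L t s (X ω) (U ω) ∂P ≤
      -(t / 4) * ∫ ω, ‖X ω‖ ^ 2 ∂P + L * d / 4 * s ^ 2 := by
  have i0 := integrable_inner_sq_mul_norm_pow_of_indepFun hX hU hXU hX2 0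
  have e0 := integral_inner_sq_mul_norm_pow_of_indepFun hX hU hXU hX2 (m := 0) (c := 1 / 2)
    (fun a => by simp only [pow_zero, mul_one, integral_inner_sq]; ring)
  simp only [pow_zero, mul_one] at i0 e0
  have i4 := integrable_norm_pow_of_hasLaw hU 4
  have e : ∫ ω, decreaseBound L t s (X ω) (U ω) ∂P =
      (-(3 / 4 * t) + L * t ^ 2 * (d + 2)) * ∫ ω, ‖X ω‖ ^ 2 ∂P +
      L * d * s ^ 2 / 8 * (L * t * (d + 2) + (L * t * (d + 2)) * (L * t * (d + 4))) := by
    simp only [decreaseBound]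
    rw [integral_add (f := fun ω => -(3 / 2 * t) * ⟪X ω, U ω⟫ ^ 2 +
      t * (L * s) ^ 2 / 2 * ‖U ω‖ ^ 4) ((i0.const_mul _).add (i4.const_mul _))
      ((integrable_secondMomentBound hX hU hXU hX2 L s).const_mul _),
      integral_add (i0.const_mul _) (i4.const_mul _), integral_const_mul, integral_const_mul,
      integral_const_mul, integral_secondMomentBound hX hU hXU hX2, e0,
      integral_norm_pow_of_hasLaw hU, integral_norm_pow_four]
    ring
  have hG : 0 ≤ ∫ ω, ‖X ω‖ ^ 2 ∂P := integral_nonneg fun ω => by positivity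
  have hLt : 0 ≤ L * t := by positivity
  have h2 : L * t * (d + 2) ≤ 1 / 2 := by linarith
  have h4 : L * t * (d + 4) ≤ 1 / 2 := by linarith
  have h5 : (L * t * (d + 2)) * (L * t * (d + 4)) ≤ 1 / 2 * (1 / 2) := by gcongr
  have h6 : L * t ^ 2 * (d + 2) ≤ t / 2 := by nlinarith
  rw [e]
  gcongr ?_ * _ + ?_
  · linarith
  · have : L * d * s ^ 2 / 8 * (L * t * (d + 2) + (L * t * (d + 2)) * (L * t * (d + 4))) ≤
        L * d * s ^ 2 / 8 * 2 := by gcongr; linarith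
    linarith

/-- One random step from `X`, with samples each independent of `X`: integrability is inherited, and
`f` decreases in mean. The lower bound on `f` serves to make the new value of `f` integrable. -/
theorem LSmooth.integrable_and_integral_le_of_step {N : ℕ} (hN : 1 ≤ N) {L : ℝ} (hL : 0 ≤ L)
    {f : EuclideanSpace ℝ (Fin d) → ℝ} (hf : LSmooth L f) (hbdd : BddBelow (Set.range f))
    {δ : ℝ → EuclideanSpace ℝ (Fin d) → EuclideanSpace ℝ (Fin d) → ℝ} {s : ℝ}
    (hδ : ∀ x v, |δ s x v - 2 * ⟪∇ f x, v⟫| ≤ L * s * ‖v‖ ^ 2) {t : ℝ} (ht : 0 ≤ t)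
    (htL : 2 * (L * t) * (d + 4) ≤ 1) {U : Fin N → Ω → EuclideanSpace ℝ (Fin d)}
    (hX : Measurable X) (hU : ∀ n, HasLaw (U n) (samplingMeasure d) P)
    (hXU : ∀ n, IndepFun X (U n) P)
    (hY : Measurable fun ω => X ω - t • mcGradient δ s (X ω) fun n => U n ω)
    (hgrad : Integrable (fun ω => ‖∇ f (X ω)‖ ^ 2) P) (hval : Integrable (fun ω => f (X ω)) P) :
    Integrable (fun ω => ‖∇ f (X ω - t • mcGradient δ s (X ω) fun n => U n ω)‖ ^ 2) P ∧
    Integrable (fun ω => f (X ω - t • mcGradient δ s (X ω) fun n => U n ω)) P ∧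
    ∫ ω, f (X ω - t • mcGradient δ s (X ω) fun n => U n ω) ∂P ≤
      ∫ ω, f (X ω) ∂P - t / 4 * ∫ ω, ‖∇ f (X ω)‖ ^ 2 ∂P + L * d / 4 * s ^ 2 := by
  have hc := hf.continuous_gradient
  have hN' : (0 : ℝ) < N := by exact_mod_cast hN
  have hA : Measurable fun ω => ∇ f (X ω) := hc.measurable.comp hX
  have hAU : ∀ n, IndepFun (fun ω => ∇ f (X ω)) (U n) P := fun n =>
    (hXU n).comp hc.measurable measurable_id
  have iS : Integrable (fun ω => 1 / (N : ℝ) *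
      ∑ n, secondMomentBound L s (∇ f (X ω)) (U n ω)) P :=
    (integrable_finsetSum _ fun n _ =>
      integrable_secondMomentBound hA (hU n) (hAU n) hgrad L s).const_mul _
  have iD : ∀ n, Integrable (fun ω => decreaseBound L t s (∇ f (X ω)) (U n ω)) P := fun n =>
    integrable_decreaseBound hA (hU n) (hAU n) hgrad L t s
  have iDs : Integrable (fun ω => 1 / (N : ℝ) *
      ∑ n, decreaseBound L t s (∇ f (X ω)) (U n ω)) P :=
    (integrable_finsetSum _ fun n _ => iD n).const_mul _
  have hstep := fun ω => hf.step_le hN hL hδ ht (X ω) fun n => U n ω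
  obtain ⟨m, hm⟩ := hbdd
  have ival : Integrable (fun ω => f (X ω - t • mcGradient δ s (X ω) fun n => U n ω)) P :=
    integrable_of_le_of_le (hf.1.continuous.measurable.comp hY).aestronglyMeasurable
      (Filter.Eventually.of_forall fun ω => hm ⟨_, rfl⟩) (Filter.Eventually.of_forall hstep)
      (integrable_const m) (hval.add iDs)
  refine ⟨?_, ival, ?_⟩
  · refine ((hgrad.const_mul 2).add (iS.const_mul (2 * (L * t) ^ 2))).mono'
      ((hc.norm.pow 2).measurable.comp hY).aestronglyMeasurable
      (Filter.Eventually.of_forall fun ω => ?_)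
    rw [Real.norm_of_nonneg (by positivity)]
    exact hf.norm_gradient_step_sq_le hδ t (X ω) fun n => U n ω
  · have h1 := integral_mono ival (hval.add iDs) hstep
    simp only [Pi.add_apply] at h1
    rw [integral_add hval iDs, integral_const_mul, integral_finsetSum _ fun n _ => iD n] at h1
    have h2 := Finset.sum_le_sum fun n (_ : n ∈ Finset.univ) =>
      integral_decreaseBound_le hA (hU n) (hAU n) hgrad hL ht htL s
    rw [Finset.sum_const, Finset.card_univ, Fintype.card_fin, nsmul_eq_mul] at h2
    have h3 := mul_le_mul_of_nonneg_left h2 (by positivity : 0 ≤ 1 / (N : ℝ))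
    rw [← mul_assoc, one_div_mul_cancel hN'.ne', one_mul] at h3
    linarith

end IndependentGaussian

/-! ### Adaptedness of the iterates -/

section Iterates

variable {d N : ℕ} {Ω : Type*}
  {δ : ℝ → EuclideanSpace ℝ (Fin d) → EuclideanSpace ℝ (Fin d) → ℝ}
  {σ : ℕ → ℝ} {t : ℝ} {x₀ : EuclideanSpace ℝ (Fin d)}
  {u : ℕ → Fin N → Ω → EuclideanSpace ℝ (Fin d)}

theorem measurable_sub_smul_mcGradient {_ : MeasurableSpace Ω} {s : ℝ}
    (hδ : Continuous fun p : EuclideanSpace ℝ (Fin d) × EuclideanSpace ℝ (Fin d) => δ s p.1 p.2)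
    (t : ℝ) {X : Ω → EuclideanSpace ℝ (Fin d)} {U : Fin N → Ω → EuclideanSpace ℝ (Fin d)}
    (hX : Measurable X) (hU : ∀ n, Measurable (U n)) :
    Measurable fun ω => X ω - t • mcGradient δ s (X ω) fun n => U n ω := by
  have h : ∀ n, Measurable fun ω => δ s (X ω) (U n ω) := fun n =>
    hδ.measurable.comp (hX.prodMk (hU n))
  simp only [mcGradient]
  fun_prop

/-- The `k`-th iterate is measurable with respect to the samples of the steps before the `k`-th. -/
theorem measurable_mcIterate_iSup_comap
    (hδ : ∀ s, Continuous fun p : EuclideanSpace ℝ (Fin d) × EuclideanSpace ℝ (Fin d) =>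
      δ s p.1 p.2) (k : ℕ) :
    Measurable[⨆ p ∈ {p : ℕ × Fin N | p.1 < k}, MeasurableSpace.comap (u p.1 p.2) inferInstance]
      (fun ω => mcIterate δ σ t x₀ (fun i n => u i n ω) k) := by
  induction k with
  | zero => simp only [mcIterate]; exact measurable_const
  | succ k ih =>
    have h1 := ih.mono (biSup_mono (f := fun p : ℕ × Fin N =>
      MeasurableSpace.comap (u p.1 p.2) inferInstance) (q := fun p => p ∈ {p | p.1 < k + 1})
      fun p hp => Nat.lt_succ_of_lt hp) le_rfl
    have h2 : ∀ n, Measurable[⨆ p ∈ {p : ℕ × Fin N | p.1 < k + 1},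
        MeasurableSpace.comap (u p.1 p.2) inferInstance] (u k n) := fun n =>
      (comap_measurable (u k n)).mono (le_biSup (fun p : ℕ × Fin N =>
        MeasurableSpace.comap (u p.1 p.2) inferInstance)
        (show (k, n) ∈ {p : ℕ × Fin N | p.1 < k + 1} from Nat.lt_succ_self k)) le_rfl
    exact measurable_sub_smul_mcGradient (hδ (σ (k + 1))) t h1 h2

variable [MeasurableSpace Ω] {P : Measure Ω}

theorem indepFun_mcIterate (hmeas : ∀ i n, Measurable (u i n))
    (hindep : iIndepFun (fun p : ℕ × Fin N => u p.1 p.2) P)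
    (hδ : ∀ s, Continuous fun p : EuclideanSpace ℝ (Fin d) × EuclideanSpace ℝ (Fin d) =>
      δ s p.1 p.2) (k : ℕ) (n : Fin N) :
    IndepFun (fun ω => mcIterate δ σ t x₀ (fun i n => u i n ω) k) (u k n) P := by
  rw [IndepFun_iff_Indep]
  have h := indep_iSup_of_disjoint (fun p : ℕ × Fin N => (hmeas p.1 p.2).comap_le)
    hindep.iIndep (S := {p : ℕ × Fin N | p.1 < k}) (T := {(k, n)}) (by simp)
  rw [iSup_singleton] at h
  exact indep_of_indep_of_le_left h
    (measurable_iff_comap_le.1 (measurable_mcIterate_iSup_comap hδ k))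

theorem measurable_mcIterate (hmeas : ∀ i n, Measurable (u i n))
    (hδ : ∀ s, Continuous fun p : EuclideanSpace ℝ (Fin d) × EuclideanSpace ℝ (Fin d) =>
      δ s p.1 p.2) (k : ℕ) :
    Measurable (fun ω => mcIterate δ σ t x₀ (fun i n => u i n ω) k) :=
  (measurable_mcIterate_iSup_comap hδ k).mono
    (iSup₂_le fun p _ => (hmeas p.1 p.2).comap_le) le_rfl

end Iterates

/-! ### The convergence estimate -/

theorem LSmooth.continuous_and_abs_sub_le_of_eq_diff {d : ℕ} {L : ℝ}
    {f : EuclideanSpace ℝ (Fin d) → ℝ} (hf : LSmooth L f)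
    {δ : ℝ → EuclideanSpace ℝ (Fin d) → EuclideanSpace ℝ (Fin d) → ℝ}
    (hδ : δ = forwardDiff f ∨ δ = centralDiff f) :
    (∀ s, Continuous fun p : EuclideanSpace ℝ (Fin d) × EuclideanSpace ℝ (Fin d) =>
      δ s p.1 p.2) ∧
    ∀ s, 0 < s → ∀ x v, |δ s x v - 2 * ⟪∇ f x, v⟫| ≤ L * s * ‖v‖ ^ 2 := by
  have hc := hf.1.continuous
  rcases hδ with rfl | rfl
  · exact ⟨fun s => by simp only [forwardDiff]; fun_prop,
      fun s hs x v => hf.abs_forwardDiff_sub_le hs x v⟩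
  · exact ⟨fun s => by simp only [centralDiff]; fun_prop,
      fun s hs x v => hf.abs_centralDiff_sub_le hs x v⟩

theorem theorem4p2 {d : ℕ} (f : EuclideanSpace ℝ (Fin d) → ℝ) (L : ℝ) (hL : 0 < L)
    (hf : LSmooth L f) (hbdd : BddBelow (Set.range f))
    (σ : ℕ → ℝ) (hσ : ∀ n, 1 ≤ n → 0 < σ n)
    (t : ℝ) (ht : 0 < t) (htL : t < 1 / (2 * L * ((d : ℝ) + 4)))
    (δ : ℝ → EuclideanSpace ℝ (Fin d) → EuclideanSpace ℝ (Fin d) → ℝ)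
    (hδ : δ = forwardDiff f ∨ δ = centralDiff f)
    (N : ℕ) (hN : 1 ≤ N) (x₀ : EuclideanSpace ℝ (Fin d))
    {Ω : Type*} [MeasurableSpace Ω] (P : MeasureTheory.Measure Ω)
    [MeasureTheory.IsProbabilityMeasure P]
    (u : ℕ → Fin N → Ω → EuclideanSpace ℝ (Fin d))
    (hmeas : ∀ i n, Measurable (u i n))
    (hlaw : ∀ i n, ProbabilityTheory.HasLaw (u i n) (samplingMeasure d) P)
    (hindep : ProbabilityTheory.iIndepFun (fun p : ℕ × Fin N => u p.1 p.2) P)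
    (x : ℕ → Ω → EuclideanSpace ℝ (Fin d))
    (hx : ∀ k ω, x k ω = mcIterate δ σ t x₀ (fun i n => u i n ω) k)
    (k : ℕ) (hk : 1 ≤ k) :
    (∀ i, MeasureTheory.Integrable (fun ω => ‖∇ f (x i ω)‖ ^ 2) P) ∧
    (∀ y, MeasureTheory.Integrable
      (fun v : EuclideanSpace ℝ (Fin d) => f (y + σ k • v) * Real.exp (-‖v‖ ^ 2))) ∧
    MeasureTheory.Integrable (fun ω => gaussSmooth f (σ k) (x k ω)) P ∧
    (Finset.range k).inf' (Finset.nonempty_range_iff.mpr (Nat.one_le_iff_ne_zero.mp hk))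
        (fun i => ∫ ω, ‖∇ f (x i ω)‖ ^ 2 ∂P) ≤
      1 / (k : ℝ) * ((N : ℝ) / ((N : ℝ) - 2 * L * t * ((d : ℝ) + 4))) *
        (4 * (f x₀ - ∫ ω, gaussSmooth f (σ k) (x k ω) ∂P) / t +
          (L ^ 3 * t * ((d : ℝ) + 6) ^ 3 / (4 * (N : ℝ)) + 2 * L * (d : ℝ) / t) *
            ∑ i ∈ Finset.Icc 1 k, σ i ^ 2) := by

  obtain rfl : x = fun k ω => mcIterate δ σ t x₀ (fun i n => u i n ω) k := by
    ext1 k; ext1 ω; exact hx k ω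
  obtain ⟨hδc, hδe⟩ := hf.continuous_and_abs_sub_le_of_eq_diff hδ
  have hd4 : 2 * (L * t) * ((d : ℝ) + 4) < 1 := by
    rw [lt_div_iff₀ (by positivity)] at htL
    linarith
  have hmX := measurable_mcIterate (σ := σ) (t := t) (x₀ := x₀) hmeas hδc
  have hstep := fun i hgrad hval => hf.integrable_and_integral_le_of_step hN hL.le hbdd
    (hδe (σ (i + 1)) (hσ _ (Nat.succ_pos i))) ht.le hd4.le (hmX i) (hlaw i)
    (indepFun_mcIterate hmeas hindep hδc i) (hmX (i + 1)) hgrad hval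
  have hint : ∀ i, Integrable
        (fun ω => ‖∇ f (mcIterate δ σ t x₀ (fun i n => u i n ω) i)‖ ^ 2) P ∧
      Integrable (fun ω => f (mcIterate δ σ t x₀ (fun i n => u i n ω) i)) P := by
    intro i
    induction i with
    | zero => simp [mcIterate]
    | succ i ih => exact ⟨(hstep i ih.1 ih.2).1, (hstep i ih.1 ih.2).2.1⟩
  set G : ℕ → ℝ := fun i =>
    ∫ ω, ‖∇ f (mcIterate δ σ t x₀ (fun i n => u i n ω) i)‖ ^ 2 ∂P with hG
  -- Summed decrease of `f`; the sum starts at the deterministic value `f x₀`.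
  have htele : ∀ m, t / 4 * ∑ i ∈ Finset.range m, G i ≤
      f x₀ - ∫ ω, f (mcIterate δ σ t x₀ (fun i n => u i n ω) m) ∂P +
        L * d / 4 * ∑ i ∈ Finset.Icc 1 m, σ i ^ 2 := by
    intro m
    induction m with
    | zero => simp [mcIterate]
    | succ m ih =>
      rw [Finset.sum_range_succ, Finset.sum_Icc_succ_top (by omega)]
      have h : ∫ ω, f (mcIterate δ σ t x₀ (fun i n => u i n ω) (m + 1)) ∂P ≤ _ :=
        (hstep m (hint m).1 (hint m).2).2.2
      simp only [hG] at ih ⊢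
      linarith
  -- Only the last value `f (x_k)` is exchanged for `gaussSmooth f (σ k) (x_k)`, at a cost of
  -- `L d σ_k² / 4`.
  have hsm := fun ω => abs_le.1
    (hf.abs_gaussSmooth_sub_le (σ k) (mcIterate δ σ t x₀ (fun i n => u i n ω) k))
  have hismooth : Integrable
      (fun ω => gaussSmooth f (σ k) (mcIterate δ σ t x₀ (fun i n => u i n ω) k)) P :=
    integrable_of_le_of_le
      ((hf.measurable_gaussSmooth (σ k)).comp (hmX k)).aestronglyMeasurable
      (Filter.Eventually.of_forall fun ω => by
        simp only [Pi.sub_apply]; linarith [(hsm ω).1])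
      (Filter.Eventually.of_forall fun ω => by
        simp only [Pi.add_apply]; linarith [(hsm ω).2])
      ((hint k).2.sub (integrable_const (L * d / 4 * σ k ^ 2)))
      ((hint k).2.add (integrable_const (L * d / 4 * σ k ^ 2)))
  refine ⟨fun i => (hint i).1, fun y => integrable_samplingMeasure_iff.1
    (hf.integrable_shift (σ k) y), hismooth, ?_⟩
  have hlast : ∫ ω, gaussSmooth f (σ k) (mcIterate δ σ t x₀ (fun i n => u i n ω) k) ∂P ≤
      ∫ ω, f (mcIterate δ σ t x₀ (fun i n => u i n ω) k) ∂P + L * d / 4 * σ k ^ 2 := by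
    have h := integral_mono hismooth ((hint k).2.add (integrable_const (L * d / 4 * σ k ^ 2)))
      fun ω => by simp only [Pi.add_apply]; linarith [(hsm ω).2]
    simpa [integral_add (hint k).2 (integrable_const (L * d / 4 * σ k ^ 2))] using h
  have hσk : σ k ^ 2 ≤ ∑ i ∈ Finset.Icc 1 k, σ i ^ 2 :=
    Finset.single_le_sum (f := fun i => σ i ^ 2) (fun i _ => sq_nonneg _)
      (Finset.mem_Icc.2 ⟨hk, le_rfl⟩)
  set S := ∑ i ∈ Finset.Icc 1 k, σ i ^ 2
  set E := ∫ ω, gaussSmooth f (σ k) (mcIterate δ σ t x₀ (fun i n => u i n ω) k) ∂P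
  have hk' : (0 : ℝ) < k := by exact_mod_cast hk
  have hN' : (1 : ℝ) ≤ N := by exact_mod_cast hN
  have hS : 0 ≤ S := Finset.sum_nonneg fun i _ => sq_nonneg _
  have hsum : ∑ i ∈ Finset.range k, G i ≤ 4 * (f x₀ - E) / t + 2 * L * d / t * S := by
    have h1 : L * d / 4 * σ k ^ 2 ≤ L * d / 4 * S := by gcongr
    have h2 := htele k
    have e : 4 * (f x₀ - E) / t + 2 * L * d / t * S =
        (f x₀ - E + L * d / 4 * S + L * d / 4 * S) / (t / 4) := by
      field_simp; ring
    rw [e, le_div_iff₀ (by positivity)]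
    linarith
  have hsum0 : 0 ≤ ∑ i ∈ Finset.range k, G i :=
    Finset.sum_nonneg fun i _ => integral_nonneg fun ω => by positivity
  have hmin : (Finset.range k).inf'
      (Finset.nonempty_range_iff.mpr (Nat.one_le_iff_ne_zero.mp hk)) G ≤
      1 / (k : ℝ) * ∑ i ∈ Finset.range k, G i := by
    have h := Finset.card_nsmul_le_sum (Finset.range k) G
      ((Finset.range k).inf' (Finset.nonempty_range_iff.mpr (Nat.one_le_iff_ne_zero.mp hk)) G)
      fun i hi => Finset.inf'_le G hi
    rw [Finset.card_range, nsmul_eq_mul] at h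
    rw [one_div, inv_mul_eq_div, le_div_iff₀ hk']
    linarith
  have hfac : 1 ≤ (N : ℝ) / ((N : ℝ) - 2 * L * t * ((d : ℝ) + 4)) := by
    have : 0 ≤ 2 * L * t * ((d : ℝ) + 4) := by positivity
    rw [le_div_iff₀ (by linarith)]
    linarith
  -- The factor and this term are slack: they only enlarge the right-hand side of `hsum`.
  have hextra : 0 ≤ L ^ 3 * t * ((d : ℝ) + 6) ^ 3 / (4 * (N : ℝ)) * S := by positivity
  refine hmin.trans ?_
  rw [mul_assoc (1 / (k : ℝ))]
  gcongr
  calc ∑ i ∈ Finset.range k, G i = 1 * ∑ i ∈ Finset.range k, G i := (one_mul _).symm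
    _ ≤ _ := by
      gcongr
      linarith
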